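/- Let $\Gamma$ be a finite group. A $\Gamma$-lattice is a finitely generated free abelian group with a linear action of $\Gamma$. It is called a permutation lattice if it has a $\mathbb{Z}$-basis permuted by $\Gamma$; a $\Gamma$-lattice $L$ is called quasi-permutation if there is a short exact sequence of $\Gamma$-lattices $0\to L\to P\to P'\to 0$ with $P$ and $P'$ permutation lattices, and quasi-invertible if it is a direct summand of a quasi-permutation $\Gamma$-lattice. Let $\alpha_1=\varepsilon_1-\varepsilon_2$ and $\alpha_2=\varepsilon_2-\varepsilon_3$ in $\mathbb{Q}^3$ be the simple roots of $A_2$, let $\mathbb{Z}A_2=\mathbb{Z}\alpha_1\oplus\mathbb{Z}\alpha_2$ be the root lattice, and let $\omega_1=\tfrac13(2\alpha_1+\alpha_2)$ be the first fundamental weight. The Weyl group $S_3=W(A_2)$ acts on $\mathbb{Q}^3$ by permuting the coordinates, and $(S_3)^m$ acts factorwise on $(\mathbb{Q}^3)^m$. Write $\omega_1^{(i)}$ for the copy of $\omega_1$ in the $i$-th factor. For $\mathbf a=(a_1,\dots,a_m)$ with each $a_i\in\{1,2\}$, let $L_{\mathbf a}\subset(\mathbb{Q}^3)^m$ be the $(S_3)^m$-lattice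 generated by $(\mathbb{Z}A_2)^m$ and $\sum_{i=1}^m a_i\,\omega_1^{(i)}$. Then for every $m\ge 2$ and every such $\mathbf a$, the $(S_3)^m$-lattice $L_{\mathbf a}$ is not quasi-invertible. -/

import Mathlib

universe u

/-! ### Lattices over a finite group

A `Γ`-lattice is a finitely generated free abelian group `L` with a representation
`ρ : Representation ℤ Γ L`. Every representation satisfying one of the predicates below
has a finitely generated free underlying group, because it embeds in one. -/

/-- A `Γ`-lattice is *permutation* if it has a (finite) `ℤ`-basis permuted by `Γ`. -/
def IsPermutationLattice {Γ : Type*} [Group Γ] {P : Type u} [AddCommGroup P]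
    (ρ : Representation ℤ Γ P) : Prop :=
  ∃ (ι : Type u) (_ : Finite ι) (b : Module.Basis ι ℤ P), ∀ (g : Γ) (i : ι), ∃ j : ι,
    ρ g (b i) = b j

/-- A `Γ`-lattice `L` is *quasi-permutation* if there is a short exact sequence
`0 → L → P → P' → 0` of `Γ`-lattices with `P` and `P'` permutation. -/
def IsQuasiPermutationLattice {Γ : Type*} [Group Γ] {L : Type u} [AddCommGroup L]
    (ρ : Representation ℤ Γ L) : Prop :=
  ∃ (P P' : Type u) (_ : AddCommGroup P) (_ : AddCommGroup P')
    (π : Representation ℤ Γ P) (π' : Representation ℤ Γ P')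
    (f : ρ.IntertwiningMap π) (g : π.IntertwiningMap π'),
    IsPermutationLattice π ∧ IsPermutationLattice π' ∧
      Function.Injective f ∧ Function.Exact f g ∧ Function.Surjective g

/-- A `Γ`-lattice `L` is *quasi-invertible* if it is a direct summand of a quasi-permutation
`Γ`-lattice `E`, i.e. `L ⊕ L' ≅ E` as `Γ`-lattices for some `L'`. -/
def IsQuasiInvertibleLattice {Γ : Type*} [Group Γ] {L : Type u} [AddCommGroup L]
    (ρ : Representation ℤ Γ L) : Prop :=
  ∃ (E L' : Type u) (_ : AddCommGroup E) (_ : AddCommGroup L')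
    (ε : Representation ℤ Γ E) (ρ' : Representation ℤ Γ L'),
    IsQuasiPermutationLattice ε ∧ Nonempty ((ρ.prod ρ').Equiv ε)

/-! ### The lattices `L_a` -/

namespace A2

/-- The simple root `α₁ = ε₁ - ε₂` of `A₂`, in the standard realization inside `ℚ³`. -/
def α₁ : Fin 3 → ℚ := Pi.single 0 1 - Pi.single 1 1

/-- The simple root `α₂ = ε₂ - ε₃` of `A₂`. -/
def α₂ : Fin 3 → ℚ := Pi.single 1 1 - Pi.single 2 1

/-- The first fundamental weight `ω₁ = (2 α₁ + α₂) / 3` of `A₂`. -/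
def ω₁ : Fin 3 → ℚ := (1 / 3 : ℚ) • ((2 : ℚ) • α₁ + α₂)

/-- The `m`-fold direct power of the root lattice `ℤA₂`, inside `(ℚ³)^m`. -/
def rootLatticePow (m : ℕ) : Submodule ℤ (Fin m → Fin 3 → ℚ) :=
  Submodule.pi Set.univ fun _ => Submodule.span ℤ {α₁, α₂}

/-- The vector `x_a = ∑ i, a i • ω₁^(i)`, where `ω₁^(i)` is the copy of `ω₁` in the `i`-th factor. -/
def weightVector {m : ℕ} (a : Fin m → ℤ) : Fin m → Fin 3 → ℚ :=
  ∑ i, a i • (Pi.single i ω₁ : Fin m → Fin 3 → ℚ)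

/-- The action of `(S₃)^m` on `(ℚ³)^m`: the `i`-th factor permutes the coordinates of the `i`-th
copy of `ℚ³`, with `σ ε_j = ε_{σ j}`. On each factor, this restricts to the action of the Weyl
group `W(A₂) = S₃`. -/
def permRep (m : ℕ) :
    Representation ℤ (Fin m → Equiv.Perm (Fin 3)) (Fin m → Fin 3 → ℚ) where
  toFun w :=
    { toFun := fun v i j => v i ((w i)⁻¹ j)
      map_add' := fun _ _ => rfl
      map_smul' := fun _ _ => rfl }
  map_one' := rfl
  map_mul' w w' := by
    ext v i j
    simp

/-- The root lattice `ℤA₂` is the group of integral vectors with coordinate sum zero. -/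
lemma mem_span_roots_iff (v : Fin 3 → ℚ) :
    v ∈ Submodule.span ℤ {α₁, α₂} ↔ (∀ j, ∃ n : ℤ, v j = n) ∧ ∑ j, v j = 0 := by
  rw [Submodule.mem_span_pair]
  constructor
  · rintro ⟨x, y, rfl⟩
    refine ⟨fun j => ?_, ?_⟩
    · fin_cases j
      · exact ⟨x, by simp [α₁, α₂]⟩
      · exact ⟨-x + y, by simp [α₁, α₂]⟩
      · exact ⟨-y, by simp [α₁, α₂]⟩
    · simp [α₁, α₂, Fin.sum_univ_three]
  · rintro ⟨h, hs⟩
    obtain ⟨x, hx⟩ := h 0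
    obtain ⟨y, hy⟩ := h 2
    refine ⟨x, -y, ?_⟩
    rw [Fin.sum_univ_three] at hs
    ext j
    fin_cases j
    · simp [α₁, α₂, hx]
    · simp [α₁, α₂]
      linarith
    · simp [α₁, α₂, hy]

lemma permRep_mem_rootLatticePow {m : ℕ} (w : Fin m → Equiv.Perm (Fin 3))
    {v : Fin m → Fin 3 → ℚ} (hv : v ∈ rootLatticePow m) :
    permRep m w v ∈ rootLatticePow m := by
  intro i _
  have h := (mem_span_roots_iff _).1 (hv i trivial)
  refine (mem_span_roots_iff _).2 ⟨fun j => h.1 ((w i)⁻¹ j), ?_⟩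
  rw [← h.2]
  exact Equiv.sum_comp (w i)⁻¹ (v i)

lemma weightVector_apply {m : ℕ} (a : Fin m → ℤ) (i : Fin m) (j : Fin 3) :
    weightVector a i j = a i * ω₁ j := by
  simp [weightVector, Finset.sum_apply, Pi.single_apply, apply_ite, ite_apply]

/-- The Weyl group acts trivially on weights modulo roots. -/
lemma permRep_weightVector_sub_mem {m : ℕ} (a : Fin m → ℤ) (w : Fin m → Equiv.Perm (Fin 3)) :
    permRep m w (weightVector a) - weightVector a ∈ rootLatticePow m := by
  have hω : ∀ j : Fin 3, ∃ n : ℤ, ω₁ j = n - 1 / 3 := by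
    intro j
    fin_cases j
    · exact ⟨1, by simp [ω₁, α₁, α₂]; norm_num⟩
    · exact ⟨0, by simp [ω₁, α₁, α₂]; norm_num⟩
    · exact ⟨0, by simp [ω₁, α₁, α₂]⟩
  intro i _
  refine (mem_span_roots_iff _).2 ⟨fun j => ?_, ?_⟩
  · obtain ⟨n, hn⟩ := hω ((w i)⁻¹ j)
    obtain ⟨k, hk⟩ := hω j
    refine ⟨a i * (n - k), ?_⟩
    change weightVector a i ((w i)⁻¹ j) - weightVector a i j = _
    rw [weightVector_apply, weightVector_apply, hn, hk]
    push_cast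
    ring
  · change ∑ j, (weightVector a i ((w i)⁻¹ j) - weightVector a i j) = 0
    rw [Finset.sum_sub_distrib, Equiv.sum_comp (w i)⁻¹ (weightVector a i), sub_self]

/-- `L_a`: the subgroup of `(ℚ³)^m` generated by `(ℤA₂)^m` and `x_a`. It is stable under
`(S₃)^m`. -/
def latticeL {m : ℕ} (a : Fin m → ℤ) : Subrepresentation (permRep m) where
  toSubmodule := rootLatticePow m ⊔ Submodule.span ℤ {weightVector a}
  apply_mem_toSubmodule w v hv := by
    obtain ⟨r, hr, s, hs, rfl⟩ := Submodule.mem_sup.1 hv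
    obtain ⟨n, rfl⟩ := Submodule.mem_span_singleton.1 hs
    rw [map_add, map_smul]
    refine Submodule.add_mem _ (Submodule.mem_sup_left (permRep_mem_rootLatticePow w hr))
      (Submodule.smul_mem _ n ?_)
    rw [← sub_add_cancel (permRep m w (weightVector a)) (weightVector a)]
    exact Submodule.add_mem _ (Submodule.mem_sup_left (permRep_weightVector_sub_mem a w))
      (Submodule.mem_sup_right (Submodule.mem_span_singleton_self _))

/-- `L_a` is finitely generated. -/
instance {m : ℕ} (a : Fin m → ℤ) : Module.Finite ℤ (latticeL a).toSubmodule := by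
  refine Module.Finite.iff_fg.2 (Submodule.FG.sup ?_ (Submodule.fg_span_singleton _))
  exact Submodule.fg_pi fun _ => Submodule.fg_span (by simp)

/-- `L_a` is a free abelian group. -/
instance {m : ℕ} (a : Fin m → ℤ) : Module.Free ℤ (latticeL a).toSubmodule :=
  inferInstance

end A2

/-! Let `c`, `d` commute, with cubes 1, and put `N = 1 + d + d²`. If `N` kills `L`, then `H¹(⟨d⟩, L)
= L/(d-1)L`. If also `(d-c)(c-1) = 0` on a quasi-invertible `L`, then `c` acts trivially on this
quotient (`IsQuasiInvertibleLattice.exists_sub_eq`).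

The reason is that a permutation lattice `P` has `H¹(⟨d⟩, P) = 0`, while its `d`-invariants modulo
norms form `𝔽₃[Y]`, with `Y` the `d`-fixed basis vectors. Over `⟨c⟩` this is a sum of trivial and
free modules, so `(c-1)²W = 0` implies `(c-1)W ∈ im (c-1)²`. This is used once in `P` and once in
`P'`, followed by a diagram chase.

For `L_a` take `d = (σ,…,σ)` and `c = (σ,1,…,1)`. Since `d-1` is injective on vectors with
coordinate sums zero, `(c-1)x_a = (d-1)z` forces `z` to be the first component of `x_a`, which is
not in `L_a` when `m ≥ 2`. -/

/-! ### Functions on sets with bijections of order three. -/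

lemma exists_orbit_section {Y : Type*} (c : Y → Y) (hc : ∀ y, c (c (c y)) = y) :
    ∃ r : Y → Y, (∀ y, r (c y) = r y) ∧ ∀ y, r y = y ∨ r y = c y ∨ r y = c (c y) := by
  let s : Setoid Y :=
    { r := fun x y => y = x ∨ y = c x ∨ y = c (c x)
      iseqv := ⟨by grind, by grind, by grind⟩ }
  refine ⟨fun y => (Quotient.mk s y).out, fun y => ?_, fun y => ?_⟩
  · exact congrArg Quotient.out (Quotient.sound (s := s) (Or.inr (Or.inr (hc y).symm)))
  · exact s.symm (Quotient.mk_out (s := s) y)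

/-- Vanishing of the first cohomology of a cyclic group of order three, on free orbits. -/
lemma exists_sub_eq_of_norm_eq_zero {Y A : Type*} [AddCommGroup A] (c : Y → Y)
    (hc : ∀ y, c (c (c y)) = y) (f : Y → A)
    (hf : ∀ y, c y ≠ y → f y + f (c y) + f (c (c y)) = 0) :
    ∃ h : Y → A, ∀ y, c y ≠ y → h (c y) - h y = f y := by
  classical
  obtain ⟨r, hr, hr'⟩ := exists_orbit_section c hc
  -- Partial sums of `f` along the orbit, starting from 0 at the representative; the last one, `f (c
  -- y) + f (c (c y))`, equals `-f y`.
  refine ⟨fun y => if r y = y then 0 else if r y = c (c y) then f (c (c y)) else -f y, ?_⟩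
  intro y hy
  have h1 := hf y hy
  have h2 := hc y
  have h3 := hr y
  have h4 : c (c y) ≠ y := by grind
  have h5 : c (c y) ≠ c y := by grind
  have h6 : f (c (c y)) = - f y - f (c y) := by
    rw [eq_sub_iff_add_eq, eq_neg_iff_add_eq_zero, ← h1]; abel
  rcases hr' y with h | h | h
  · simp [h3, h, hy.symm, h2]
  · simp [h3, h, hy, h5.symm]
  · simp [h3, h, h2, h5, h4, h6]
    abel

/-- On a free orbit, placing the common value at one point and 0 elsewhere gives the right sum; only
fixed points, where a norm is `3 * u x`, impose a condition. -/
lemma exists_eq_norm {X : Type*} (d : X → X) (hd : ∀ x, d (d (d x)) = x) (f : X → ℤ)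
    (hf : ∀ x, f (d x) = f x) (h3 : ∀ x, d x = x → (3 : ℤ) ∣ f x) :
    ∃ u : X → ℤ, ∀ x, u x + u (d x) + u (d (d x)) = f x := by
  classical
  obtain ⟨r, hr, hr'⟩ := exists_orbit_section d hd
  refine ⟨fun x => if d x = x then f x / 3 else if r x = x then f x else 0, fun x => ?_⟩
  by_cases hx : d x = x
  · have := h3 x hx
    simp only [hx, if_true]
    omega
  · have h2 := hd x
    have h4 : d (d x) ≠ x := by grind
    have h5 : d (d x) ≠ d x := by grind
    rcases hr' x with h | h | h
    · simp [hr, h, hx, h5, h2, h4.symm, Ne.symm hx]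
    · simp [hr, h, hx, h5, h2, h4.symm, Ne.symm h5, hf]
    · simp [hr, h, hx, h5, h2, h4, h4.symm, hf]

/-- Vanishing of the first cohomology with values in functions on a set with two commuting
bijections of order three. -/
lemma exists_common_primitive {X : Type*} (d c : X → X) (hd : ∀ x, d (d (d x)) = x)
    (hc : ∀ x, c (c (c x)) = x) (hdc : ∀ x, d (c x) = c (d x)) (u v : X → ℤ)
    (hu : ∀ x, u x + u (d x) + u (d (d x)) = 0) (hv : ∀ x, v x + v (c x) + v (c (c x)) = 0)
    (huv : ∀ x, u (c x) - u x = v (d x) - v x) :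
    ∃ p : X → ℤ, (∀ x, p (d x) - p x = u x) ∧ ∀ x, p (c x) - p x = v x := by
  obtain ⟨p₀, hp₀⟩ := exists_sub_eq_of_norm_eq_zero d hd u fun x _ => hu x
  replace hp₀ : ∀ x, p₀ (d x) - p₀ x = u x := fun x => by
    by_cases hx : d x = x
    · have := hu x
      simp only [hx] at this ⊢
      omega
    · exact hp₀ x hx
  -- The error left in the `c`-equation is `d`-invariant, so it is corrected by a function on
  -- `d`-orbits, which does not disturb the `d`-equation.
  let R : X → X → Prop := fun x y => y = d x
  let w : Quot R → ℤ := Quot.lift (fun x => v x - (p₀ (c x) - p₀ x)) (by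
    rintro x _ rfl
    have h1 := hp₀ x
    have h2 := hp₀ (c x)
    have h3 := huv x
    rw [hdc] at h2
    linarith)
  let cQ : Quot R → Quot R := Quot.map c (by
    rintro x _ rfl
    exact (hdc x).symm)
  have hcQ : ∀ y, cQ (cQ (cQ y)) = y := by
    rintro ⟨x⟩
    exact congrArg (Quot.mk R) (hc x)
  have hw : ∀ y, w y + w (cQ y) + w (cQ (cQ y)) = 0 := by
    rintro ⟨x⟩
    change (v x - (p₀ (c x) - p₀ x)) + (v (c x) - (p₀ (c (c x)) - p₀ (c x))) +
      (v (c (c x)) - (p₀ (c (c (c x))) - p₀ (c (c x)))) = 0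
    rw [hc]
    linarith [hv x]
  obtain ⟨h, hh⟩ := exists_sub_eq_of_norm_eq_zero cQ hcQ w fun y _ => hw y
  replace hh : ∀ y, h (cQ y) - h y = w y := fun y => by
    by_cases hy : cQ y = y
    · have := hw y
      simp only [hy] at this ⊢
      omega
    · exact hh y hy
  refine ⟨fun x => p₀ x + h (Quot.mk R x), fun x => ?_, fun x => ?_⟩
  · have : Quot.mk R (d x) = Quot.mk R x := (Quot.sound (r := R) rfl).symm
    simp only [this]
    linarith [hp₀ x]
  · have : h (Quot.mk R (c x)) - h (Quot.mk R x) = v x - (p₀ (c x) - p₀ x) := hh (Quot.mk R x)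
    linarith

/-- Modulo norms, the invariants of `d` in a permutation lattice have no Jordan block of size two
under `c`. -/
lemma exists_second_difference {X : Type*} (d c : X → X) (hd : ∀ x, d (d (d x)) = x)
    (hc : ∀ x, c (c (c x)) = x) (hdc : ∀ x, d (c x) = c (d x)) (W u₀ : X → ℤ)
    (hW : ∀ x, W (d x) = W x)
    (h : ∀ x, W (c (c x)) - 2 * W (c x) + W x = u₀ x + u₀ (d x) + u₀ (d (d x))) :
    ∃ U u : X → ℤ, (∀ x, U (d x) = U x) ∧
      ∀ x, W (c x) - W x = U (c (c x)) - 2 * U (c x) + U x + (u x + u (d x) + u (d (d x))) := by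
  classical
  let Y := {x // d x = x}
  let cY : Y → Y := fun y => ⟨c y, by rw [hdc, y.2]⟩
  have hcY : ∀ y, cY (cY (cY y)) = y := fun y => Subtype.ext (hc y)
  -- Since `1 + c + c² = (c-1)² + 3c`, the hypothesis makes the `c`-norm of `W` vanish mod 3 at
  -- `d`-fixed points. Hence `W = (c-1)k` mod 3 on free `c`-orbits.
  obtain ⟨k, hk⟩ := exists_sub_eq_of_norm_eq_zero cY hcY (fun y => (W y : ZMod 3)) (by
    intro y _
    have h1 := h y
    simp only [y.2] at h1
    have h2 : W y + W (cY y) + W (cY (cY y)) = 3 * (u₀ y + W (c y)) := by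
      change W y + W (c y) + W (c (c y)) = _
      linarith
    have := congrArg (Int.cast : ℤ → ZMod 3) h2
    push_cast at this
    rw [this]
    have h4 : (3 : ZMod 3) = 0 := by decide
    rw [h4, zero_mul])
  -- The value off the `d`-fixed points is immaterial, as long as `U` is `d`-invariant: there every
  -- `d`-invariant function is a norm.
  let U : X → ℤ := fun x => if hx : d x = x then ((k ⟨x, hx⟩).val : ℤ) else 0
  have hU : ∀ y : Y, ((U y : ℤ) : ZMod 3) = k y := fun y => by
    simp [U, y.2]
  have hUd : ∀ x, U (d x) = U x := fun x => by
    by_cases hx : d x = x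
    · rw [hx]
    · have : d (d x) ≠ d x := by grind
      simp [U, hx, this]
  obtain ⟨u, hu⟩ := exists_eq_norm d hd
    (fun x => W (c x) - W x - (U (c (c x)) - 2 * U (c x) + U x)) (fun x => by
      simp only [← hdc, hW, hUd]) (fun x hx => by
      refine (ZMod.intCast_zmod_eq_zero_iff_dvd _ 3).1 ?_
      by_cases hcx : c x = x
      · simp only [hcx]
        push_cast
        ring
      · let y : Y := ⟨x, hx⟩
        have hy : cY y ≠ y := fun h => hcx (congrArg Subtype.val h)
        have hy' : cY (cY y) ≠ cY y := fun h => hy (by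
          have h1 := congrArg cY h
          rw [hcY] at h1
          exact h.symm.trans h1.symm)
        have h1 := hk y hy
        have h2 := hk (cY y) hy'
        rw [← hU, ← hU] at h1 h2
        change (U (c x) : ZMod 3) - U x = W x at h1
        change (U (c (c x)) : ZMod 3) - U (c x) = W (c x) at h2
        push_cast
        rw [← h1, ← h2]
        ring)
  exact ⟨U, u, hUd, fun x => by linarith [hu x]⟩

/-! ### Permutation lattices and the obstruction. -/

lemma IsPermutationLattice.exists_equiv_fun {Γ : Type*} [Group Γ] {P : Type u} [AddCommGroup P]
    {π : Representation ℤ Γ P} (h : IsPermutationLattice π) :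
    ∃ (X : Type u) (e : P ≃ₗ[ℤ] (X → ℤ)) (τ : Γ → X → X),
      (∀ g p x, e (π g p) x = e p (τ g x)) ∧ (∀ x, τ 1 x = x) ∧
        ∀ g g' x, τ (g * g') x = τ g' (τ g x) := by
  classical
  obtain ⟨X, _, b, hb⟩ := h
  have := Fintype.ofFinite X
  choose σ hσ using hb
  have h1 : ∀ x, σ 1 x = x := fun x => b.injective (by rw [← hσ, map_one]; rfl)
  have hmul : ∀ g g' x, σ (g * g') x = σ g (σ g' x) := fun g g' x =>
    b.injective (by rw [← hσ, map_mul, Module.End.mul_apply, hσ, hσ])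
  refine ⟨X, b.equivFun, fun g => σ g⁻¹, fun g p x => ?_, fun x => by simp [h1],
    fun g g' x => by simp [hmul]⟩
  let φ : P →ₗ[ℤ] ℤ := LinearMap.proj x ∘ₗ b.equivFun.toLinearMap ∘ₗ π g
  let ψ : P →ₗ[ℤ] ℤ := LinearMap.proj (σ g⁻¹ x) ∘ₗ b.equivFun.toLinearMap
  have : φ = ψ := b.ext fun i => by
    have h2 : σ g i = x ↔ i = σ g⁻¹ x := by
      constructor
      · rintro rfl
        rw [← hmul, inv_mul_cancel, h1]
      · rintro rfl
        rw [← hmul, mul_inv_cancel, h1]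
    simp [φ, ψ, hσ, h2]
  exact LinearMap.congr_fun this p

section

variable {Γ : Type*} [Group Γ] {P : Type u} [AddCommGroup P] {π : Representation ℤ Γ P}
  {c d : Γ}

lemma IsPermutationLattice.exists_common_primitive (h : IsPermutationLattice π)
    (hd : d * (d * d) = 1) (hc : c * (c * c) = 1) (hcd : c * d = d * c) (u v : P)
    (hu : u + π d u + π d (π d u) = 0) (hv : v + π c v + π c (π c v) = 0)
    (huv : π c u - u = π d v - v) : ∃ p, π d p - p = u ∧ π c p - p = v := by
  obtain ⟨X, e, τ, he, h1, hmul⟩ := h.exists_equiv_fun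
  obtain ⟨p, hp, hp'⟩ := _root_.exists_common_primitive (τ d) (τ c)
    (fun x => by rw [← hmul, ← hmul, hd, h1]) (fun x => by rw [← hmul, ← hmul, hc, h1])
    (fun x => by rw [← hmul, hcd, hmul]) (e u) (e v)
    (fun x => by simpa [he] using congrFun (congrArg e hu) x)
    (fun x => by simpa [he] using congrFun (congrArg e hv) x)
    (fun x => by simpa [he] using congrFun (congrArg e huv) x)
  refine ⟨e.symm p, e.injective (funext fun x => ?_), e.injective (funext fun x => ?_)⟩
  · simpa [he] using hp x
  · simpa [he] using hp' x

lemma IsPermutationLattice.exists_second_difference (h : IsPermutationLattice π)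
    (hd : d * (d * d) = 1) (hc : c * (c * c) = 1) (hcd : c * d = d * c) (W u₀ : P)
    (hW : π d W = W)
    (hu₀ : π c (π c W) - (2 : ℤ) • π c W + W = u₀ + π d u₀ + π d (π d u₀)) :
    ∃ U u : P, π d U = U ∧
      π c W - W = π c (π c U) - (2 : ℤ) • π c U + U + (u + π d u + π d (π d u)) := by
  obtain ⟨X, e, τ, he, h1, hmul⟩ := h.exists_equiv_fun
  obtain ⟨U, u, hU, hu⟩ := _root_.exists_second_difference (τ d) (τ c)
    (fun x => by rw [← hmul, ← hmul, hd, h1]) (fun x => by rw [← hmul, ← hmul, hc, h1])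
    (fun x => by rw [← hmul, hcd, hmul]) (e W) (e u₀)
    (fun x => by simpa [he] using congrFun (congrArg e hW) x)
    (fun x => by simpa [he] using congrFun (congrArg e hu₀) x)
  refine ⟨e.symm U, e.symm u, e.injective (funext fun x => ?_), e.injective (funext fun x => ?_)⟩
  · simpa [he] using hU x
  · simpa [he] using hu x

/-- An obstruction to quasi-invertibility detected by two commuting elements of order three. -/
theorem IsQuasiInvertibleLattice.exists_sub_eq {L : Type u} [AddCommGroup L]
    {ρ : Representation ℤ Γ L} (h : IsQuasiInvertibleLattice ρ)
    (hd : d * (d * d) = 1) (hc : c * (c * c) = 1) (hcd : c * d = d * c)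
    (hN : ∀ v, v + ρ d v + ρ d (ρ d v) = 0)
    (ht : ∀ v, ρ d (ρ c v - v) = ρ c (ρ c v - v)) (ℓ : L) :
    ∃ z, ρ d z - z = ρ c ℓ - ℓ := by
  obtain ⟨E, L', _, _, ε, ρ', ⟨P, P', _, _, π, π', f, g, hP, hP', hf, hfg, hg⟩, ⟨φ⟩⟩ := h
  obtain ⟨i, hi, pr, hpr, hpri, hker⟩ : ∃ i : L →ₗ[ℤ] P, (∀ γ v, i (ρ γ v) = π γ (i v)) ∧
      ∃ pr : E →ₗ[ℤ] L, (∀ γ v, pr (ε γ v) = ρ γ (pr v)) ∧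
      (∀ v, ∃ w, f w = i v ∧ pr w = v) ∧ ∀ v, g (i v) = 0 := by
    refine ⟨f.toLinearMap ∘ₗ φ.toLinearMap ∘ₗ LinearMap.inl ℤ L L', fun γ v => ?_,
      LinearMap.fst ℤ L L' ∘ₗ φ.toLinearEquiv.symm.toLinearMap, fun γ v => ?_, fun v => ?_,
      fun v => ?_⟩
    · have h1 := φ.toIntertwiningMap.isIntertwining _ _ γ (v, 0)
      have h2 := f.isIntertwining _ _ γ (φ.toIntertwiningMap (v, 0))
      rw [← h1] at h2
      simpa using h2
    · obtain ⟨w, rfl⟩ := φ.toLinearEquiv.surjective v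
      have h1 : φ.toLinearEquiv ((ρ.prod ρ') γ w) = ε γ (φ.toLinearEquiv w) :=
        φ.toIntertwiningMap.isIntertwining _ _ γ w
      change (φ.toLinearEquiv.symm (ε γ (φ.toLinearEquiv w))).1 =
        ρ γ (φ.toLinearEquiv.symm (φ.toLinearEquiv w)).1
      rw [← h1, LinearEquiv.symm_apply_apply, LinearEquiv.symm_apply_apply]
      rfl
    · exact ⟨φ.toLinearEquiv (v, 0), rfl, congrArg Prod.fst (φ.toLinearEquiv.symm_apply_apply (v, 0))⟩
    · exact (hfg _).2 ⟨_, rfl⟩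
  have hgπ : ∀ γ p, g (π γ p) = π' γ (g p) := g.isIntertwining _ _
  have hfε : ∀ γ p, f (ε γ p) = π γ (f p) := f.isIntertwining _ _
  have hd' : ∀ p, π d (π d (π d p)) = p := fun p => by
    rw [← Module.End.mul_apply, ← Module.End.mul_apply, ← map_mul, ← map_mul, mul_assoc, hd,
      map_one]; rfl
  have hc' : ∀ p, π c (π c (π c p)) = p := fun p => by
    rw [← Module.End.mul_apply, ← Module.End.mul_apply, ← map_mul, ← map_mul, mul_assoc, hc,
      map_one]; rfl
  have hcd' : ∀ p, π c (π d p) = π d (π c p) := fun p => by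
    rw [← Module.End.mul_apply, ← map_mul, hcd, map_mul]; rfl
  set t : L := ρ c ℓ - ℓ with htℓ
  have hi_norm : ∀ v, i v + π d (i v) + π d (π d (i v)) = 0 := fun v => by
    rw [← hi, ← hi, ← map_add, ← map_add, hN, map_zero]
  -- Taking `c = 1` leaves only `H¹(⟨d⟩, P) = 0`, giving `(d-1)pe = i ℓ`.
  obtain ⟨pe, hpe, -⟩ := hP.exists_common_primitive (c := 1) hd (by simp) (by simp) (i ℓ) 0
    (hi_norm ℓ) (by simp) (by simp)
  have hit : π d (i t) = π c (i t) := by rw [← hi, ← hi, ht]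
  have hti : i t = π c (i ℓ) - i ℓ := by rw [htℓ, map_sub, hi]
  obtain ⟨py, hpy, hpy'⟩ := hP.exists_common_primitive hd hc hcd (i t) (i t) (hi_norm t)
    (by rw [← hit, hcd', ← hit]; exact hi_norm t) (by rw [hit])
  have epe : π d pe = pe + i ℓ := by rw [← hpe]; abel
  have epy : π d py = py + i t := by rw [← hpy]; abel
  have epy' : π c py = py + i t := by rw [← hpy']; abel
  -- `W = (c-1)pe - py` is `d`-invariant, and `(c-1)²W` is the norm of `-(cW + py)`.
  obtain ⟨U, u, hU, hu⟩ := hP.exists_second_difference hd hc hcd (π c pe - pe - py)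
    (-(π c (π c pe - pe - py) + py))
    (by simp only [map_sub, ← hcd', epe, epy, map_add, hti]; abel)
    (by
      have e1 : π d (π c pe) = π c pe + π c (i ℓ) := by rw [← hcd', epe, map_add]
      have e2 : π d (π c (π c pe)) = π c (π c pe) + π c (π c (i ℓ)) := by
        rw [← hcd', e1, map_add]
      have e3 : π d (π c (i ℓ)) = π c (π c (i ℓ)) - π c (i ℓ) + π d (i ℓ) := by
        rw [hti, map_sub, map_sub] at hit
        rw [← hit]
        abel
      have e4 : π c (π c pe - pe - py) + py = π c (π c pe) - π c pe - π c (i ℓ) + i ℓ := by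
        rw [map_sub, map_sub, epy', hti]
        abel
      have e5 : π d (π c (π c pe) - π c pe - π c (i ℓ) + i ℓ) = π c (π c pe) - π c pe := by
        rw [map_add, map_sub, map_sub, e1, e2, e3]
        abel
      rw [e4, map_neg, map_neg, e5, map_sub (π d), e1, e2]
      simp only [map_sub, map_add, epy', hc', hti]
      module)
  -- Correcting `pe` by `U` makes `(c-1)² g(pe - U)` the norm of `g u`, because `(c-1)py = i t` dies
  -- under `g`.
  obtain ⟨r, s, hr, hs⟩ := hP'.exists_second_difference hd hc hcd (g (pe - U)) (g u)
    (by rw [← hgπ]; simp [epe, hU, hker]) (by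
      have h1 := congrArg g hu
      have h2 : π' c (g py) = g py := by rw [← hgπ, epy', map_add, hker, add_zero]
      simp only [map_add, map_sub, map_smul, hgπ, h2] at h1 ⊢
      linear_combination (norm := module) h1)
  obtain ⟨r, rfl⟩ := hg r
  obtain ⟨s, rfl⟩ := hg s
  obtain ⟨e₂, he₂⟩ := (hfg (π d r - r)).1 (by rw [map_sub, hgπ, hr, sub_self])
  obtain ⟨e, he⟩ := (hfg (π c (pe - U) - (pe - U) - (π c (π c r) - (2 : ℤ) • π c r + r) -
    (s + π d s + π d (π d s)))).1 (by
      rw [map_sub, map_sub, sub_sub, sub_eq_zero]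
      simpa [hgπ] using hs)
  obtain ⟨w, hw, hw'⟩ := hpri ℓ
  -- Apply `d-1` to `he`: the norm of `s` and the `d`-invariant `U` disappear.
  have key : ε d e - e = ε c w - w - (ε c (ε c e₂) - (2 : ℤ) • ε c e₂ + e₂) := hf (by
    simp only [map_sub, map_add, map_smul, hfε, he, he₂, hw, hd', ← hcd', epe, hU]
    module)
  have key' := congrArg pr key
  simp only [map_sub, map_add, map_smul, hpr, hw'] at key'
  have h1 := ht (pr e₂)
  simp only [map_sub] at h1
  -- On `L`, `(c-1)² = (d-1)(c-1)`, so the second-difference term also lies in the image of `d-1`.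
  refine ⟨pr e + (ρ c (pr e₂) - pr e₂), ?_⟩
  simp only [map_add, map_sub, htℓ]
  linear_combination (norm := module) key' + h1

end

/-! ### The obstruction for the lattices `L_a`. -/

namespace A2

lemma sum_eq_zero_of_mem_latticeL {m : ℕ} {a : Fin m → ℤ} {v : Fin m → Fin 3 → ℚ}
    (hv : v ∈ (latticeL a).toSubmodule) (i : Fin m) : v i 0 + v i 1 + v i 2 = 0 := by
  obtain ⟨r, hr, s, hs, rfl⟩ := Submodule.mem_sup.1 hv
  obtain ⟨n, rfl⟩ := Submodule.mem_span_singleton.1 hs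
  have h := ((mem_span_roots_iff _).1 (hr i trivial)).2
  rw [Fin.sum_univ_three] at h
  simp only [Pi.add_apply, Pi.smul_apply, weightVector_apply, ω₁, α₁, α₂]
  simp
  linarith

lemma exists_coord_two_eq {m : ℕ} {a : Fin m → ℤ} {v : Fin m → Fin 3 → ℚ}
    (hv : v ∈ (latticeL a).toSubmodule) :
    ∃ n : ℤ, ∀ i, ∃ k : ℤ, v i 2 = k - n * a i / 3 := by
  obtain ⟨r, hr, s, hs, rfl⟩ := Submodule.mem_sup.1 hv
  obtain ⟨n, rfl⟩ := Submodule.mem_span_singleton.1 hs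
  refine ⟨n, fun i => ?_⟩
  obtain ⟨k, hk⟩ := ((mem_span_roots_iff _).1 (hr i trivial)).1 2
  refine ⟨k, ?_⟩
  simp only [Pi.add_apply, Pi.smul_apply, weightVector_apply, hk, ω₁, α₁, α₂]
  simp
  ring

end A2

theorem mainTheorem10 (m : ℕ) (hm : 2 ≤ m) (a : Fin m → ℤ) (ha : ∀ i, a i = 1 ∨ a i = 2) :
    ¬ IsQuasiInvertibleLattice (A2.latticeL a).toRepresentation := by
  intro h
  -- The inverse makes the action on vectors precomposition with `finRotate 3`.
  let σ : Equiv.Perm (Fin 3) := (finRotate 3)⁻¹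
  have hσ : σ * (σ * σ) = 1 := by decide
  let i₀ : Fin m := ⟨0, by omega⟩
  let i₁ : Fin m := ⟨1, by omega⟩
  have hi : i₁ ≠ i₀ := by simp [i₀, i₁]
  let d : Fin m → Equiv.Perm (Fin 3) := fun _ => σ
  let c : Fin m → Equiv.Perm (Fin 3) := Pi.mulSingle i₀ σ
  have hd (v : Fin m → Fin 3 → ℚ) (i : Fin m) (j : Fin 3) :
      A2.permRep m d v i j = v i (finRotate 3 j) := rfl
  have hc₀ (v : Fin m → Fin 3 → ℚ) (j : Fin 3) :
      A2.permRep m c v i₀ j = v i₀ (finRotate 3 j) := by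
    change v i₀ ((c i₀)⁻¹ j) = _
    simp [c, σ]
  have hc₁ (v : Fin m → Fin 3 → ℚ) {i : Fin m} (hi : i ≠ i₀) (j : Fin 3) :
      A2.permRep m c v i j = v i j := by
    change v i ((c i)⁻¹ j) = _
    simp [c, hi]
  have r0 : finRotate 3 0 = 1 := rfl
  have r1 : finRotate 3 1 = 2 := rfl
  have r2 : finRotate 3 2 = 0 := rfl
  obtain ⟨⟨z, hz⟩, hzc⟩ := h.exists_sub_eq (c := c) (d := d) (funext fun _ => hσ)
    (by rw [← Pi.mulSingle_mul, ← Pi.mulSingle_mul, hσ, Pi.mulSingle_one])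
    (by
      ext1 i
      by_cases hi : i = i₀
      · subst hi
        simp [c, d]
      · simp [c, d, hi])
    (by
      rintro ⟨v, hv⟩
      refine Subtype.ext (funext fun i => funext fun j => ?_)
      have h1 := A2.sum_eq_zero_of_mem_latticeL hv i
      change v i j + v i (finRotate 3 j) + v i (finRotate 3 (finRotate 3 j)) = 0
      fin_cases j
      · simpa [r0, r1, r2] using h1
      · simp [r1, r2]
        linarith
      · simp [r0, r2]
        linarith)
    (by
      rintro ⟨v, hv⟩
      refine Subtype.ext (funext fun i => funext fun j => ?_)
      change A2.permRep m d (A2.permRep m c v - v) i j =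
        A2.permRep m c (A2.permRep m c v - v) i j
      by_cases hi : i = i₀
      · subst hi
        rw [hd, hc₀]
      · rw [hd, hc₁ _ hi]
        simp [hc₁ _ hi])
    ⟨A2.weightVector a, Submodule.mem_sup_right (Submodule.mem_span_singleton_self _)⟩
  have hzc' : A2.permRep m d z - z =
      A2.permRep m c (A2.weightVector a) - A2.weightVector a := congrArg Subtype.val hzc
  have e (i j) := congrFun (congrFun hzc' i) j
  simp only [Pi.sub_apply, hd] at e
  have hz₀ : z i₀ 2 = -(a i₀ : ℚ) / 3 := by
    have h0 := e i₀ 0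
    have h1 := e i₀ 1
    have h2 := A2.sum_eq_zero_of_mem_latticeL hz i₀
    simp only [hc₀, A2.weightVector_apply, r0, r1] at h0 h1
    simp [A2.ω₁, A2.α₁, A2.α₂] at h0 h1
    linarith
  have hz₁ : z i₁ 2 = 0 := by
    have h0 := e i₁ 0
    have h1 := e i₁ 1
    have h2 := A2.sum_eq_zero_of_mem_latticeL hz i₁
    simp only [hc₁ _ hi, r0, r1] at h0 h1
    linarith
  -- One `n` governs all factors: `i₀` forces `n ≡ 1` mod 3, while `i₁` forces `3 ∣ n`, both `a i`
  -- being prime to 3.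
  obtain ⟨n, hn⟩ := A2.exists_coord_two_eq hz
  obtain ⟨k₀, hk₀⟩ := hn i₀
  obtain ⟨k₁, hk₁⟩ := hn i₁
  have h0 : n * a i₀ = 3 * k₀ + a i₀ := by
    rw [hz₀] at hk₀
    have : (n * a i₀ : ℚ) = 3 * k₀ + a i₀ := by linarith
    exact_mod_cast this
  have h1 : n * a i₁ = 3 * k₁ := by
    rw [hz₁] at hk₁
    have : (n * a i₁ : ℚ) = 3 * k₁ := by linarith
    exact_mod_cast this
  rcases ha i₀ with h2 | h2 <;> rcases ha i₁ with h3 | h3 <;> rw [h2] at h0 <;>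
    rw [h3] at h1 <;> omega
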